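/- Let $E$ be a Polish space, let $D=D(\mathbb R_+,E)$ be the space of càdlàg paths in $E$ with its Borel $\sigma$-field $\mathcal D$ (generated by the coordinates $Y_t$), and let $\mathcal D_t=\bigcap_{s>t}\sigma(Y_u,\,u\le s)$ be the canonical right-continuous filtration. Let $(\mathrm P_x)_{x\in E}$ be a Borel strong Markov process on $(D,\mathcal D,\mathcal D_t)$ with $\mathrm P_x(Y_0=x)=1$, whose semigroup $P_tf(x)=\mathrm E_x[f(Y_t)]$ maps $\mathcal C_b(E)$ into $\mathcal C_b(E)$. Its generator $\mathcal L$ is defined as follows: $f\in\mathcal D(\mathcal L)$ and $\mathcal Lf=g$ if $f,g\in\mathcal C_b(E)$ and, for every $x\in E$, the process $f(Y_t)-f(x)-\int_0^t g(Y_s)\,ds$ is a $(\mathcal D_t)$-martingale under $\mathrm P_x$. Let $\beta\in\mathcal C_b(E)$ and let $\lambda_0\in\mathbb R$ (of any sign) and $\phi_0$ satisfy: (H8) $\phi_0\in\mathcal D(\mathcal L)$, $(\beta-\mathcal L)\phi_0=\lambda_0\phi_0$, and there are constants $C_1,C_2>0$ with $C_1\le\phi_0(x)\le C_2$ for all $x\in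 E$. Let $\mathrm P^{\phi_0}_x$ be the probability measure on $(D,\mathcal D)$ such that, for all $t\ge0$, $$\frac{d\mathrm P^{\phi_0}_{x\,|\mathcal D_t}}{d\mathrm P_{x\,|\mathcal D_t}}=\frac{\phi_0(Y_t)}{\phi_0(Y_0)}\,e^{-\int_0^t(\beta(Y_s)-\lambda_0)\,ds},$$ and assume: (H9) the process with laws $(\mathrm P^{\phi_0}_x)_{x\in E}$ admits a stationary probability measure $\pi$ on $E$, and for every $x\in E$ $$\sup_{f\text{ measurable},\ \|f\|_\infty\le1}\big|\mathrm E^{\phi_0}_x[f(Y_t)]-\pi(f)\big|\xrightarrow[t\to\infty]{}0 .$$ For $t\ge0$ let $\mathrm P^{(B,t)}_x$ be the Feynman–Kac penalized law $$\frac{d\mathrm P^{(B,t)}_{x\,|\mathcal D_t}}{d\mathrm P_{x\,|\mathcal D_t}}=\frac{e^{-\int_0^t\beta(Y_s)\,ds}}{\mathrm E_x\big[e^{-\int_0^t\beta(Y_s)\,ds}\big]} .$$ Then, for every $x\in E$ and $t_0\ge0$, $$\frac{d\mathrm P^{(B,t)}_{x\,|\mathcal D_{t_0}}}{d\mathrm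 P_{x\,|\mathcal D_{t_0}}}\xrightarrow[t\to\infty,\ t\ge t_0]{}\frac{d\mathrm P^{\phi_0}_{x\,|\mathcal D_{t_0}}}{d\mathrm P_{x\,|\mathcal D_{t_0}}}\qquad\mathrm P_x\text{-a.s. and in }L^1(\mathrm P_x),$$ where the densities on the left are taken in versions that are continuous in $t\in[t_0,\infty)$; such versions exist. -/

import Mathlib

open MeasureTheory ProbabilityTheory Filter Topology
open scoped NNReal ENNReal BoundedContinuousFunction

/-- The space `D(ℝ₊, E)` of càdlàg paths in `E`. -/
structure CadlagPath (E : Type*) [TopologicalSpace E] where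
  toFun : ℝ≥0 → E
  rightCont : ∀ t, ContinuousWithinAt toFun (Set.Ici t) t
  leftLim : ∀ t, ∃ l, Tendsto toFun (𝓝[<] t) (𝓝 l)

namespace CadlagPath

variable {E : Type*} [TopologicalSpace E]

instance : CoeFun (CadlagPath E) (fun _ => ℝ≥0 → E) := ⟨CadlagPath.toFun⟩

/-- The σ-field `𝒟` generated by the coordinates `Y_t : ω ↦ ω t`. For a Polish space `E` this is
the Borel σ-field of the Skorokhod topology. -/
instance [MeasurableSpace E] : MeasurableSpace (CadlagPath E) :=
  ⨆ t : ℝ≥0, MeasurableSpace.comap (fun ω : CadlagPath E => ω t) inferInstance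

/-- The raw canonical filtration `σ(Y_s, s ≤ t)`. -/
def rawFiltration (E : Type*) [TopologicalSpace E] [MeasurableSpace E] :
    Filtration ℝ≥0 (inferInstance : MeasurableSpace (CadlagPath E)) where
  seq t := ⨆ s : ℝ≥0, ⨆ _ : s ≤ t,
    MeasurableSpace.comap (fun ω : CadlagPath E => ω s) inferInstance
  mono' _ _ hst := biSup_mono fun _ h => h.trans hst
  le' _ := iSup₂_le fun s _ =>
    le_iSup (fun s : ℝ≥0 => MeasurableSpace.comap (fun ω : CadlagPath E => ω s) inferInstance) s

/-- The canonical right-continuous filtration `𝒟_t = ⋂_{s > t} σ(Y_u, u ≤ s)`. -/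
noncomputable def filtration (E : Type*) [TopologicalSpace E] [MeasurableSpace E] :
    Filtration ℝ≥0 (inferInstance : MeasurableSpace (CadlagPath E)) :=
  (rawFiltration E).rightCont

/-- The shift `θ_s ω = ω (s + ·)`. -/
def shift (s : ℝ≥0) (ω : CadlagPath E) : CadlagPath E where
  toFun t := ω (s + t)
  rightCont t := by
    refine ContinuousWithinAt.comp (t := Set.Ici (s + t)) (ω.rightCont (s + t)) ?_ ?_
    · exact (continuous_const.add continuous_id).continuousWithinAt
    · intro u hu
      exact add_le_add_right (Set.mem_Ici.1 hu) s
  leftLim t := by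
    obtain ⟨l, hl⟩ := ω.leftLim (s + t)
    refine ⟨l, hl.comp ?_⟩
    refine tendsto_nhdsWithin_iff.2 ⟨?_, ?_⟩
    · exact ((continuous_const.add continuous_id).tendsto t).mono_left nhdsWithin_le_nhds
    · filter_upwards [self_mem_nhdsWithin] with u hu
      exact add_lt_add_right (Set.mem_Iio.1 hu) s

end CadlagPath

section Spine

variable {E : Type*} [TopologicalSpace E] [MeasurableSpace E]

/-- `(P_x)` is a Borel strong Markov process with càdlàg paths in `E`, whose semigroup
`P_t f (x) = E_x[f(Y_t)]` maps `C_b` into `C_b`. Measurability of `x ↦ P_x(B)` is part of the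
notion of a kernel. -/
structure IsBorelStrongMarkov (P : Kernel E (CadlagPath E)) : Prop where
  isMarkovKernel : IsMarkovKernel P
  start : ∀ x, ∀ᵐ ω ∂(P x), ω 0 = x
  /-- `P_x(θ_τ ∈ B | 𝒟_τ) = P_{Y_τ}(B)` on `{τ < ∞}`, for every stopping time `τ`. -/
  strongMarkov : ∀ (x : E) (τ : CadlagPath E → WithTop ℝ≥0)
    (hτ : IsStoppingTime (CadlagPath.filtration E) τ) (A B : Set (CadlagPath E)),
    MeasurableSet[hτ.measurableSpace] A → MeasurableSet B →
      P x (A ∩ {ω | τ ω < ⊤} ∩ {ω | CadlagPath.shift ((τ ω).untopD 0) ω ∈ B}) =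
        ∫⁻ ω in A ∩ {ω | τ ω < ⊤}, P (ω ((τ ω).untopD 0)) B ∂(P x)
  continuous_semigroup : ∀ (t : ℝ≥0) (f : E →ᵇ ℝ), Continuous fun x => ∫ ω, f (ω t) ∂(P x)

/-- `∫₀ᵗ g(Y_s) ds`. -/
noncomputable def pathIntegral (g : E → ℝ) (t : ℝ≥0) (ω : CadlagPath E) : ℝ :=
  ∫ s in (0 : ℝ)..(t : ℝ), g (ω s.toNNReal)

/-- `f` belongs to the domain of the generator `ℒ` of `(P_x)`, and `ℒ f = g`. -/
def IsGenerator (P : Kernel E (CadlagPath E)) (f g : E →ᵇ ℝ) : Prop :=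
  ∀ x, Martingale (fun (t : ℝ≥0) (ω : CadlagPath E) => f (ω t) - f x - pathIntegral g t ω)
    (CadlagPath.filtration E) (P x)

/-- `φ ∈ 𝒟(ℒ)` and `(β - ℒ) φ = lam φ`. -/
def IsEigenfunction (P : Kernel E (CadlagPath E)) (β φ : E →ᵇ ℝ) (lam : ℝ) : Prop :=
  ∃ g : E →ᵇ ℝ, IsGenerator P φ g ∧ ∀ x, β x * φ x - g x = lam * φ x

/-- `Z` is a (version of the) Radon–Nikodym derivative of `μ` restricted to the sub-σ-field `m`
with respect to `ν` restricted to `m`. -/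
def IsRNDerivOn {Ω : Type*} (m : MeasurableSpace Ω) {_m0 : MeasurableSpace Ω} (μ ν : Measure Ω)
    (Z : Ω → ℝ) : Prop :=
  Measurable[m] Z ∧ (∀ ω, 0 ≤ Z ω) ∧
    ∀ A, MeasurableSet[m] A → μ A = ∫⁻ ω in A, ENNReal.ofReal (Z ω) ∂ν

/-- `Q = P_x^φ`: for all `t`, on `𝒟_t`, `dQ / dP_x = φ(Y_t) / φ(Y_0) · exp(-∫₀ᵗ (β(Y_s) - lam) ds)`. -/
def IsSpineLaw (P : Kernel E (CadlagPath E)) (β φ : E → ℝ) (lam : ℝ) (x : E)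
    (Q : Measure (CadlagPath E)) : Prop :=
  ∀ t : ℝ≥0, IsRNDerivOn (CadlagPath.filtration E t) Q (P x)
    fun ω => φ (ω t) / φ (ω 0) * Real.exp (-pathIntegral (fun y => β y - lam) t ω)

open Classical in
/-- The law `P_x^φ`; the measure characterised by `IsSpineLaw` is unique, since the `𝒟_t` increase
and generate `𝒟`. -/
noncomputable def spineLaw (P : Kernel E (CadlagPath E)) (β φ : E → ℝ) (lam : ℝ) (x : E) :
    Measure (CadlagPath E) :=
  if h : ∃ Q, IsSpineLaw P β φ lam x Q then h.choose else 0

/-- The process with laws `P_x^φ` admits a stationary probability measure `π`, and for every `x` the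
law of `Y_t` under `P_x^φ` converges to `π` in total variation as `t → ∞`. -/
def IsErgodicSpine (P : Kernel E (CadlagPath E)) (β φ : E → ℝ) (lam : ℝ) : Prop :=
  ∃ π : Measure E, IsProbabilityMeasure π ∧
    (∀ (t : ℝ≥0) (A : Set E), MeasurableSet A →
      ∫⁻ x, spineLaw P β φ lam x {ω | ω t ∈ A} ∂π = π A) ∧
    ∀ x, Tendsto (fun t : ℝ≥0 => ⨆ f : {f : E → ℝ // Measurable f ∧ ∀ y, |f y| ≤ 1},
      ENNReal.ofReal |∫ ω, f.1 (ω t) ∂(spineLaw P β φ lam x) - ∫ y, f.1 y ∂π|) atTop (𝓝 0)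

/-- The Feynman–Kac penalized law `P_x^{(B,t)}`, with density
`exp(-∫₀ᵗ β(Y_s) ds) / E_x[exp(-∫₀ᵗ β(Y_s) ds)]` with respect to `P_x`. -/
noncomputable def penalizedLaw (P : Kernel E (CadlagPath E)) (β : E → ℝ) (t : ℝ≥0) (x : E) :
    Measure (CadlagPath E) :=
  (P x).withDensity fun ω => ENNReal.ofReal
    (Real.exp (-pathIntegral β t ω) / ∫ ω', Real.exp (-pathIntegral β t ω') ∂(P x))

end Spine

/-! Write m_t(y) for the Feynman–Kac mass E_y[exp(-∫₀ᵗ β)]. By the Markov property at t₀, the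
penalized density on 𝒟_{t₀} is exp(-∫₀^{t₀} β) m_{t-t₀}(Y_{t₀}) / m_t(x), so everything rests on the
large-time behaviour of m.

Integrating 1/φ₀(Y_t) against the spine law removes φ₀(Y_t) from its density and gives e^{λ₀t}
m_t(y) = φ₀(y) E^{φ₀}_y[1/φ₀(Y_t)] (`IsSpineLaw.exp_mul_feynmanKacMass`). As 1/φ₀ is bounded,
ergodicity makes this converge to φ₀(y) π(1/φ₀) (`IsErgodicSpine.exists_tendsto_feynmanKacMass`). In
the ratio the constant π(1/φ₀) cancels and the spine density remains.

The bounds C₁ ≤ φ₀ ≤ C₂ confine e^{λ₀t} m_t(y) to an interval independent of t and y, so the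
densities are dominated by a constant and dominated convergence gives the L¹ limit. -/

namespace CadlagPath

variable {E : Type*} [TopologicalSpace E]

/-! ### Measurability of coordinates and shifts -/

lemma measurable_eval_rawFiltration [MeasurableSpace E] {s t : ℝ≥0} (hst : s ≤ t) :
    Measurable[rawFiltration E t] (fun ω : CadlagPath E => ω s) :=
  Measurable.of_comap_le (le_iSup₂ (f := fun (s : ℝ≥0) (_ : s ≤ t) =>
    MeasurableSpace.comap (fun ω : CadlagPath E => ω s) inferInstance) s hst)

lemma measurable_eval_filtration [MeasurableSpace E] {s t : ℝ≥0} (hst : s ≤ t) :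
    Measurable[filtration E t] (fun ω : CadlagPath E => ω s) :=
  (measurable_eval_rawFiltration hst).mono ((rawFiltration E).le_rightCont t) le_rfl

lemma measurable_eval [MeasurableSpace E] (s : ℝ≥0) :
    Measurable (fun ω : CadlagPath E => ω s) :=
  (measurable_eval_filtration le_rfl).mono ((filtration E).le s) le_rfl

lemma measurable_shift [MeasurableSpace E] (s : ℝ≥0) :
    Measurable (shift s : CadlagPath E → CadlagPath E) := by
  refine measurable_iff_comap_le.2 ?_
  simp only [instMeasurableSpace, MeasurableSpace.comap_iSup, MeasurableSpace.comap_comp]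
  exact iSup_le fun t => (measurable_eval (s + t)).comap_le

/-- A path stopped at `t` is the limit of its values along a grid approached from the right. -/
lemma tendsto_eval_grid (ω : CadlagPath E) (s t : ℝ≥0) :
    Tendsto (fun n : ℕ => ω (min ((⌊((n : ℝ≥0) + 1) * s⌋₊ + 1) / (n + 1)) t)) atTop
      (𝓝 (ω (min s t))) := by
  refine (ω.rightCont (min s t)).tendsto.comp (tendsto_nhdsWithin_iff.2 ⟨?_, ?_⟩)
  · refine Tendsto.min ?_ tendsto_const_nhds
    have hu : Tendsto (fun n : ℕ => s + 1 / ((n : ℝ≥0) + 1)) atTop (𝓝 s) := by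
      simpa using tendsto_const_nhds.add (tendsto_one_div_add_atTop_nhds_zero_nat (𝕜 := ℝ≥0))
    refine tendsto_of_tendsto_of_tendsto_of_le_of_le tendsto_const_nhds hu ?_ ?_
    · intro n
      have hn : (0 : ℝ≥0) < n + 1 := by positivity
      rw [le_div_iff₀ hn, mul_comm]
      exact (Nat.lt_floor_add_one _).le
    · intro n
      have hn : (0 : ℝ≥0) < n + 1 := by positivity
      simp only [add_div]
      gcongr
      rw [div_le_iff₀ hn, mul_comm s]
      exact Nat.floor_le zero_le
  · refine Eventually.of_forall fun n => ?_
    have hn : (0 : ℝ≥0) < n + 1 := by positivity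
    refine min_le_min_right t ?_
    rw [le_div_iff₀ hn, mul_comm]
    exact (Nat.lt_floor_add_one _).le

/-- Progressive measurability of `g(Y_s)`. -/
lemma measurable_eval_min [MeasurableSpace E] [OpensMeasurableSpace E] {g : E → ℝ}
    (hg : Continuous g) (t : ℝ≥0) :
    Measurable[Prod.instMeasurableSpace (m₂ := rawFiltration E t)]
      (fun p : ℝ × CadlagPath E => g (p.2 (min p.1.toNNReal t))) := by
  let m : MeasurableSpace (CadlagPath E) := rawFiltration E t
  refine measurable_of_tendsto_metrizable (f := fun (n : ℕ) (p : ℝ × CadlagPath E) =>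
    g (p.2 (min ((⌊((n : ℝ≥0) + 1) * p.1.toNNReal⌋₊ + 1) / (n + 1)) t))) (fun n => ?_) ?_
  -- Each approximant depends on time only through a floor, hence factors through the countable type
  -- `ℕ`; the cap at `t` keeps it measurable for the σ-field at `t`.
  · have h : @Measurable (ℕ × CadlagPath E) ℝ (Prod.instMeasurableSpace (m₂ := m)) _
        (fun q : ℕ × CadlagPath E => g (q.2 (min (((q.1 : ℝ≥0) + 1) / (n + 1)) t))) :=
      measurable_from_prod_countable_right fun k =>
        hg.measurable.comp (measurable_eval_rawFiltration
          (min_le_right (((k : ℝ≥0) + 1) / (n + 1)) t))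
    have h' : @Measurable (ℝ × CadlagPath E) (ℕ × CadlagPath E)
        (Prod.instMeasurableSpace (m₂ := m)) (Prod.instMeasurableSpace (m₂ := m))
        (fun p => (⌊((n : ℝ≥0) + 1) * p.1.toNNReal⌋₊, p.2)) := by
      refine Measurable.prodMk (Nat.measurable_floor.comp ?_) measurable_snd
      exact (measurable_real_toNNReal.comp measurable_fst).const_mul _
    exact h.comp h'
  · exact tendsto_pi_nhds.2 fun p =>
      (hg.tendsto _).comp (tendsto_eval_grid p.2 p.1.toNNReal t)

end CadlagPath

/-! ### Path integrals and the Feynman–Kac mass -/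

section Spine

variable {E : Type*} [TopologicalSpace E]

/-- Freezing the path at `t` makes the integrand jointly measurable for the σ-field at `t`, whence
adaptedness. -/
lemma pathIntegral_eq_setIntegral (g : E → ℝ) (t : ℝ≥0) (ω : CadlagPath E) :
    pathIntegral g t ω = ∫ s in Set.Ioc (0 : ℝ) t, g (ω (min s.toNNReal t)) := by
  rw [pathIntegral, intervalIntegral.integral_of_le t.coe_nonneg]
  refine setIntegral_congr_fun measurableSet_Ioc fun s hs => ?_
  have : s.toNNReal ≤ t := Real.toNNReal_le_iff_le_coe.2 hs.2
  simp only [min_eq_left this]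

lemma abs_pathIntegral_le (g : E →ᵇ ℝ) (t : ℝ≥0) (ω : CadlagPath E) :
    |pathIntegral g t ω| ≤ ‖g‖ * t := by
  have := intervalIntegral.norm_integral_le_of_norm_le_const (a := 0) (b := (t : ℝ))
    (f := fun s => g (ω s.toNNReal)) (C := ‖g‖) fun s _ => g.norm_coe_le_norm _
  simpa [pathIntegral] using this

lemma exp_neg_pathIntegral_le (g : E →ᵇ ℝ) (t : ℝ≥0) (ω : CadlagPath E) :
    Real.exp (-pathIntegral g t ω) ≤ Real.exp (‖g‖ * t) :=
  Real.exp_le_exp.2 ((neg_le_abs _).trans (abs_pathIntegral_le g t ω))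

variable [MeasurableSpace E]

lemma measurable_pathIntegral [OpensMeasurableSpace E] {g : E → ℝ} (hg : Continuous g)
    (t : ℝ≥0) : Measurable[CadlagPath.filtration E t] (pathIntegral g t) := by
  refine Measurable.mono ?_ ((CadlagPath.rawFiltration E).le_rightCont t) le_rfl
  have h := (CadlagPath.measurable_eval_min hg t).stronglyMeasurable
  rw [show pathIntegral g t = _ from funext (pathIntegral_eq_setIntegral g t)]
  exact (@StronglyMeasurable.integral_prod_left' _ _ _ _ (CadlagPath.rawFiltration E t)
    (volume.restrict (Set.Ioc (0 : ℝ) t)) _ _ _ _ h).measurable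

lemma intervalIntegrable_eval [OpensMeasurableSpace E] (g : E →ᵇ ℝ) (a b : ℝ≥0)
    (ω : CadlagPath E) :
    IntervalIntegrable (fun s : ℝ => g (ω s.toNNReal)) volume a b := by
  refine (intervalIntegrable_const (c := ‖g‖)).mono_fun ?_ ?_
  · set T := max a b
    have h : Measurable fun s : ℝ => g (ω (min s.toNNReal T)) :=
      (CadlagPath.measurable_eval_min g.continuous T).comp
        (@measurable_prodMk_right _ _ _ (CadlagPath.rawFiltration E T) ω)
    refine h.aestronglyMeasurable.congr ?_
    filter_upwards [ae_restrict_mem measurableSet_uIoc] with s hs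
    have : s.toNNReal ≤ T := by
      rw [Real.toNNReal_le_iff_le_coe, NNReal.coe_max]
      exact hs.2
    rw [min_eq_left this]
  · exact ae_of_all _ fun s => by simpa using g.norm_coe_le_norm _

lemma continuous_pathIntegral [OpensMeasurableSpace E] (g : E →ᵇ ℝ) (ω : CadlagPath E) :
    Continuous fun t => pathIntegral g t ω := by
  rw [continuous_iff_continuousAt]
  intro t
  have h := intervalIntegral.continuousOn_primitive_interval' (a := (0 : ℝ)) (b₁ := 0)
    (b₂ := (t + 1 : ℝ≥0)) (by simpa using intervalIntegrable_eval g 0 (t + 1) ω) (by simp)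
  have h' := h.comp (s := Set.Iic (t + 1)) NNReal.continuous_coe.continuousOn fun s hs => by
    rw [Set.uIcc_of_le (NNReal.coe_nonneg _)]
    exact ⟨s.2, NNReal.coe_le_coe.2 hs⟩
  exact h'.continuousAt (Iic_mem_nhds (by simp))

/-- Additivity along the shift is what makes the exponential weight multiplicative, so that the
Markov property applies to it. -/
lemma pathIntegral_add [OpensMeasurableSpace E] (g : E →ᵇ ℝ) (s t : ℝ≥0) (ω : CadlagPath E) :
    pathIntegral g (s + t) ω = pathIntegral g s ω + pathIntegral g t (CadlagPath.shift s ω) := by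
  have h := intervalIntegral.integral_add_adjacent_intervals
    (by simpa using intervalIntegrable_eval g 0 s ω) (intervalIntegrable_eval g s (s + t) ω)
  rw [pathIntegral, ← h, pathIntegral, pathIntegral]
  congr 1
  have h' := intervalIntegral.integral_comp_add_left (a := 0) (b := (t : ℝ))
    (fun u => g (ω u.toNNReal)) (s : ℝ)
  rw [add_zero, ← NNReal.coe_add] at h'
  rw [← h']
  refine intervalIntegral.integral_congr fun u hu => ?_
  rw [Set.uIcc_of_le t.coe_nonneg] at hu
  simp only [CadlagPath.shift]
  rw [Real.toNNReal_add s.coe_nonneg hu.1, Real.toNNReal_coe]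

lemma pathIntegral_sub_const [OpensMeasurableSpace E] (g : E →ᵇ ℝ) (c : ℝ) (t : ℝ≥0)
    (ω : CadlagPath E) :
    pathIntegral (fun y => g y - c) t ω = pathIntegral g t ω - c * t := by
  rw [pathIntegral, pathIntegral, intervalIntegral.integral_sub
    (by simpa using intervalIntegrable_eval g 0 t ω) intervalIntegrable_const]
  simp [mul_comm]

/-- The Feynman–Kac semigroup applied to the constant function `1`. -/
noncomputable def feynmanKacMass (P : Kernel E (CadlagPath E)) (β : E → ℝ) (t : ℝ≥0) (x : E) : ℝ :=
  ∫ ω, Real.exp (-pathIntegral β t ω) ∂(P x)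

variable [OpensMeasurableSpace E]

lemma measurable_exp_neg_pathIntegral {g : E → ℝ} (hg : Continuous g) (t : ℝ≥0) :
    Measurable[CadlagPath.filtration E t] fun ω => Real.exp (-pathIntegral g t ω) :=
  Real.measurable_exp.comp (measurable_pathIntegral hg t).neg

lemma measurable_exp_neg_pathIntegral' {g : E → ℝ} (hg : Continuous g) (t : ℝ≥0) :
    Measurable fun ω : CadlagPath E => Real.exp (-pathIntegral g t ω) :=
  (measurable_exp_neg_pathIntegral hg t).mono ((CadlagPath.filtration E).le t) le_rfl

variable (P : Kernel E (CadlagPath E)) (β : E →ᵇ ℝ)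

lemma measurable_feynmanKacMass (t : ℝ≥0) : Measurable (feynmanKacMass P β t) :=
  (StronglyMeasurable.integral_kernel
    (measurable_exp_neg_pathIntegral' β.continuous t).stronglyMeasurable).measurable

variable [IsMarkovKernel P]

lemma integrable_exp_neg_pathIntegral (t : ℝ≥0) (x : E) :
    Integrable (fun ω => Real.exp (-pathIntegral β t ω)) (P x) :=
  Integrable.of_bound (measurable_exp_neg_pathIntegral' β.continuous t).aestronglyMeasurable
    (Real.exp (‖β‖ * t)) (ae_of_all _ fun ω => by
      simpa using exp_neg_pathIntegral_le β t ω)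

lemma feynmanKacMass_pos (t : ℝ≥0) (x : E) : 0 < feynmanKacMass P β t x :=
  integral_exp_pos (integrable_exp_neg_pathIntegral P β t x)

lemma ofReal_feynmanKacMass (t : ℝ≥0) (x : E) :
    ENNReal.ofReal (feynmanKacMass P β t x) =
      ∫⁻ ω, ENNReal.ofReal (Real.exp (-pathIntegral β t ω)) ∂(P x) :=
  ofReal_integral_eq_lintegral_ofReal (integrable_exp_neg_pathIntegral P β t x)
    (ae_of_all _ fun _ => (Real.exp_pos _).le)

lemma continuous_feynmanKacMass (x : E) : Continuous fun t => feynmanKacMass P β t x := by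
  rw [continuous_iff_continuousAt]
  intro t
  refine continuousAt_of_dominated (bound := fun _ => Real.exp (‖β‖ * (t + 1 : ℝ≥0))) ?_ ?_
    (integrable_const _) ?_
  · exact Eventually.of_forall fun s =>
      (measurable_exp_neg_pathIntegral' β.continuous s).aestronglyMeasurable
  · filter_upwards [Iic_mem_nhds (show t < t + 1 by simp)] with s hs
    refine ae_of_all _ fun ω => ?_
    rw [Real.norm_eq_abs, Real.abs_exp]
    refine (exp_neg_pathIntegral_le β s ω).trans (Real.exp_le_exp.2 ?_)
    exact mul_le_mul_of_nonneg_left (NNReal.coe_le_coe.2 hs) (norm_nonneg _)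
  · exact ae_of_all _ fun ω =>
      (Real.continuous_exp.comp (continuous_pathIntegral β ω).neg).continuousAt

end Spine

/-! ### Change of measure and the Markov property -/

lemma IsRNDerivOn.lintegral_eq {Ω : Type*} {m m0 : MeasurableSpace Ω} {μ ν : Measure Ω}
    {Z : Ω → ℝ} (hm : m ≤ m0) (h : IsRNDerivOn m μ ν Z) {f : Ω → ℝ≥0∞} (hf : Measurable[m] f) :
    ∫⁻ ω, f ω ∂μ = ∫⁻ ω, ENNReal.ofReal (Z ω) * f ω ∂ν := by
  have hZ : Measurable[m] fun ω => ENNReal.ofReal (Z ω) := ENNReal.measurable_ofReal.comp h.1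
  have key : μ.trim hm = (ν.withDensity fun ω => ENNReal.ofReal (Z ω)).trim hm := by
    refine @Measure.ext _ m _ _ fun A hA => ?_
    rw [trim_measurableSet_eq hm hA, trim_measurableSet_eq hm hA, h.2.2 A hA,
      withDensity_apply _ (hm A hA)]
  rw [← lintegral_trim hm hf, key, lintegral_trim hm hf,
    lintegral_withDensity_eq_lintegral_mul _ (hZ.mono hm le_rfl) (hf.mono hm le_rfl)]
  rfl

section Spine

variable {E : Type*} [TopologicalSpace E] [MeasurableSpace E] {P : Kernel E (CadlagPath E)}

/-- The Markov property at the deterministic time `t`. -/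
lemma IsBorelStrongMarkov.setLIntegral_shift (hP : IsBorelStrongMarkov P) (x : E) (t : ℝ≥0)
    {A : Set (CadlagPath E)} (hA : MeasurableSet[CadlagPath.filtration E t] A)
    {F : CadlagPath E → ℝ≥0∞} (hF : Measurable F) :
    ∫⁻ ω in A, F (CadlagPath.shift t ω) ∂(P x) = ∫⁻ ω in A, ∫⁻ ω', F ω' ∂(P (ω t)) ∂(P x) := by
  have hk : Measurable fun ω : CadlagPath E => P (ω t) :=
    P.measurable.comp (CadlagPath.measurable_eval t)
  have key : ((P x).restrict A).map (CadlagPath.shift t) =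
      ((P x).restrict A).bind fun ω => P (ω t) := by
    refine Measure.ext fun B hB => ?_
    have h := hP.strongMarkov x (fun _ => (t : WithTop ℝ≥0)) (isStoppingTime_const _ t) A B
      (by rwa [IsStoppingTime.measurableSpace_const]) hB
    rw [Measure.map_apply (CadlagPath.measurable_shift t) hB,
      Measure.restrict_apply (CadlagPath.measurable_shift t hB),
      Measure.bind_apply hB hk.aemeasurable]
    have htop : {_ω : CadlagPath E | (t : WithTop ℝ≥0) < ⊤} = Set.univ :=
      Set.eq_univ_of_forall fun _ => WithTop.coe_lt_top t
    rw [htop, Set.inter_univ] at h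
    rw [Set.inter_comm]
    exact h
  rw [← lintegral_map hF (CadlagPath.measurable_shift t), key,
    Measure.lintegral_bind hk.aemeasurable hF.aemeasurable]

/-- Weighted by the future functional or by its conditional mean, the two measures agree on the
σ-field at `t`, and `G` sees nothing finer. -/
lemma IsBorelStrongMarkov.lintegral_mul_shift (hP : IsBorelStrongMarkov P) (x : E) (t : ℝ≥0)
    {G F : CadlagPath E → ℝ≥0∞} (hG : Measurable[CadlagPath.filtration E t] G)
    (hF : Measurable F) {A : Set (CadlagPath E)}
    (hA : MeasurableSet[CadlagPath.filtration E t] A) :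
    ∫⁻ ω in A, G ω * F (CadlagPath.shift t ω) ∂(P x) =
      ∫⁻ ω in A, G ω * ∫⁻ ω', F ω' ∂(P (ω t)) ∂(P x) := by
  have hm := (CadlagPath.filtration E).le t
  have hF₁ : Measurable fun ω => F (CadlagPath.shift t ω) :=
    hF.comp (CadlagPath.measurable_shift t)
  have hF₂ : Measurable fun ω : CadlagPath E => ∫⁻ ω', F ω' ∂(P (ω t)) :=
    hF.lintegral_kernel.comp (CadlagPath.measurable_eval t)
  have key : (((P x).restrict A).withDensity fun ω => F (CadlagPath.shift t ω)).trim hm =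
      (((P x).restrict A).withDensity fun ω => ∫⁻ ω', F ω' ∂(P (ω t))).trim hm := by
    refine @Measure.ext _ (CadlagPath.filtration E t) _ _ fun B hB => ?_
    rw [trim_measurableSet_eq hm hB, trim_measurableSet_eq hm hB,
      withDensity_apply _ (hm B hB), withDensity_apply _ (hm B hB),
      Measure.restrict_restrict (hm B hB)]
    exact hP.setLIntegral_shift x t (hB.inter hA) hF
  have h₁ := lintegral_withDensity_eq_lintegral_mul ((P x).restrict A) hF₁ (hG.mono hm le_rfl)
  have h₂ := lintegral_withDensity_eq_lintegral_mul ((P x).restrict A) hF₂ (hG.mono hm le_rfl)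
  rw [← lintegral_trim hm hG, key, lintegral_trim hm hG, h₂] at h₁
  simpa [mul_comm] using h₁.symm

/-- The default value 0 is excluded: tested against the constant 1, it stays at distance 1 from the
probability π for all times. -/
lemma IsErgodicSpine.isSpineLaw {β φ : E → ℝ} {lam : ℝ} (h : IsErgodicSpine P β φ lam) (x : E) :
    IsSpineLaw P β φ lam x (spineLaw P β φ lam x) := by
  by_cases hex : ∃ Q, IsSpineLaw P β φ lam x Q
  · rw [spineLaw, dif_pos hex]
    exact hex.choose_spec
  · obtain ⟨π, hπ, -, hlim⟩ := h
    have h0 : spineLaw P β φ lam x = 0 := by rw [spineLaw, dif_neg hex]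
    have hle : (1 : ℝ≥0∞) ≤ 0 := by
      refine ge_of_tendsto' (hlim x) fun t => ?_
      refine le_iSup_of_le ⟨fun _ => 1, measurable_const, by simp⟩ ?_
      simp [h0]
    simp at hle

/-- At time 0 the density is identically 1, so the total mass is that of `P x`. -/
lemma IsSpineLaw.isProbabilityMeasure (hP : IsBorelStrongMarkov P) {β φ : E → ℝ} {lam : ℝ}
    (hφ : ∀ y, 0 < φ y) {x : E} {Q : Measure (CadlagPath E)} (hQ : IsSpineLaw P β φ lam x Q) :
    IsProbabilityMeasure Q := by
  have := hP.isMarkovKernel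
  refine ⟨?_⟩
  rw [(hQ 0).2.2 Set.univ MeasurableSet.univ]
  simp [pathIntegral, div_self (hφ _).ne']

/-- Convergence in total variation, tested against a bounded measurable function. -/
lemma tendsto_integral_of_tendsto_iSup {β φ : E → ℝ} {lam : ℝ} {π : Measure E} {x : E}
    (h : Tendsto (fun t : ℝ≥0 => ⨆ f : {f : E → ℝ // Measurable f ∧ ∀ y, |f y| ≤ 1},
      ENNReal.ofReal |∫ ω, f.1 (ω t) ∂(spineLaw P β φ lam x) - ∫ y, f.1 y ∂π|) atTop (𝓝 0))
    {f : E → ℝ} (hf : Measurable f) {C : ℝ} (hC : 0 < C) (hfC : ∀ y, |f y| ≤ C) :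
    Tendsto (fun t : ℝ≥0 => ∫ ω, f (ω t) ∂(spineLaw P β φ lam x)) atTop (𝓝 (∫ y, f y ∂π)) := by
  let f' : {f : E → ℝ // Measurable f ∧ ∀ y, |f y| ≤ 1} := ⟨fun y => C⁻¹ * f y,
    hf.const_mul _, fun y => by
      rw [abs_mul, abs_of_pos (inv_pos.2 hC), inv_mul_le_iff₀ hC, mul_one]
      exact hfC y⟩
  have h₁ : Tendsto (fun t : ℝ≥0 => ENNReal.ofReal
      |∫ ω, f'.1 (ω t) ∂(spineLaw P β φ lam x) - ∫ y, f'.1 y ∂π|) atTop (𝓝 0) :=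
    tendsto_of_tendsto_of_tendsto_of_le_of_le tendsto_const_nhds h (fun _ => zero_le)
      fun t => le_iSup (fun f : {f : E → ℝ // Measurable f ∧ ∀ y, |f y| ≤ 1} => ENNReal.ofReal
        |∫ ω, f.1 (ω t) ∂(spineLaw P β φ lam x) - ∫ y, f.1 y ∂π|) f'
  have h₂ := (ENNReal.tendsto_toReal ENNReal.zero_ne_top).comp h₁
  simp only [Function.comp_def, ENNReal.toReal_ofReal (abs_nonneg _), ENNReal.toReal_zero] at h₂
  have h₃ := (tendsto_iff_norm_sub_tendsto_zero.2 h₂).const_mul C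
  simpa [f', integral_const_mul, mul_inv_cancel_left₀ hC.ne'] using h₃

/-! ### Penalized densities and the normalised mass -/

/-- The density of the penalized law on `𝒟_s`, in a version continuous in `t ≥ s`. -/
noncomputable def penalizedDensity (P : Kernel E (CadlagPath E)) (β : E → ℝ) (x : E)
    (s t : ℝ≥0) (ω : CadlagPath E) : ℝ :=
  Real.exp (-pathIntegral β s ω) * feynmanKacMass P β (t - s) (ω s) / feynmanKacMass P β t x

variable [OpensMeasurableSpace E]

lemma isRNDerivOn_penalizedLaw (hP : IsBorelStrongMarkov P) (β : E →ᵇ ℝ) (x : E) {s t : ℝ≥0}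
    (hst : s ≤ t) :
    IsRNDerivOn (CadlagPath.filtration E s) (penalizedLaw P β t x) (P x)
      (penalizedDensity P β x s t) := by
  have := hP.isMarkovKernel
  have hexp := measurable_exp_neg_pathIntegral β.continuous s
  have hpos := feynmanKacMass_pos P β
  refine ⟨?_, fun ω => ?_, fun A hA => ?_⟩
  · exact (hexp.mul ((measurable_feynmanKacMass P β (t - s)).comp
      (CadlagPath.measurable_eval_filtration le_rfl))).div_const _
  · exact div_nonneg (mul_nonneg (Real.exp_pos _).le (hpos _ _).le) (hpos _ _).le
  · rw [penalizedLaw, withDensity_apply _ ((CadlagPath.filtration E).le s A hA)]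
    have h := hP.lintegral_mul_shift x s
      (G := fun ω => ENNReal.ofReal (Real.exp (-pathIntegral β s ω) / feynmanKacMass P β t x))
      (F := fun ω => ENNReal.ofReal (Real.exp (-pathIntegral β (t - s) ω)))
      (ENNReal.measurable_ofReal.comp (hexp.div_const _))
      (ENNReal.measurable_ofReal.comp (measurable_exp_neg_pathIntegral' β.continuous _)) hA
    have hG : ∀ ω : CadlagPath E,
        0 ≤ Real.exp (-pathIntegral β s ω) / feynmanKacMass P β t x := fun ω =>
      div_nonneg (Real.exp_pos _).le (hpos _ _).le
    simp only [← ofReal_feynmanKacMass, ← ENNReal.ofReal_mul (hG _)] at h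
    convert h using 4 with ω ω
    · have := pathIntegral_add β s (t - s) ω
      rw [add_tsub_cancel_of_le hst] at this
      rw [this, neg_add, Real.exp_add, mul_div_right_comm, feynmanKacMass]
    · rw [penalizedDensity, mul_div_right_comm]

/-- Truncated subtraction is continuous, so continuity holds on all of `ℝ≥0`, not only for `t ≥ s`.
-/
lemma continuous_penalizedDensity [IsMarkovKernel P] (β : E →ᵇ ℝ) (x : E) (s : ℝ≥0)
    (ω : CadlagPath E) : Continuous fun t => penalizedDensity P β x s t ω :=
  (continuous_const.mul ((continuous_feynmanKacMass P β (ω s)).comp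
    (continuous_id.sub continuous_const))).div (continuous_feynmanKacMass P β x)
      fun t => (feynmanKacMass_pos P β t x).ne'

/-- The many-to-one formula for the reciprocal of the eigenfunction. -/
lemma IsSpineLaw.exp_mul_feynmanKacMass (hP : IsBorelStrongMarkov P) {β φ : E →ᵇ ℝ} {lam : ℝ}
    (hφ : ∀ y, 0 < φ y) {x : E} {Q : Measure (CadlagPath E)} (hQ : IsSpineLaw P β φ lam x Q)
    (t : ℝ≥0) :
    Real.exp (lam * t) * feynmanKacMass P β t x = φ x * ∫ ω, (φ (ω t))⁻¹ ∂Q := by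
  have := hP.isMarkovKernel
  have hm := (CadlagPath.filtration E).le t
  have hmeas : Measurable[CadlagPath.filtration E t] fun ω : CadlagPath E => (φ (ω t))⁻¹ :=
    (φ.continuous.measurable.comp (CadlagPath.measurable_eval_filtration le_rfl)).inv
  have h := (hQ t).lintegral_eq hm (ENNReal.measurable_ofReal.comp hmeas)
  -- The factor φ(Y_t) cancels, and φ(Y_0) = φ(x) almost surely.
  have hae : ∀ᵐ ω ∂(P x), ENNReal.ofReal (φ (ω t) / φ (ω 0) *
        Real.exp (-pathIntegral (fun y => β y - lam) t ω)) * ENNReal.ofReal (φ (ω t))⁻¹ =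
      ENNReal.ofReal ((φ x)⁻¹ * Real.exp (lam * t)) *
        ENNReal.ofReal (Real.exp (-pathIntegral β t ω)) := by
    filter_upwards [hP.start x] with ω hω
    have h₁ := hφ (ω t)
    have h₂ := hφ x
    rw [← ENNReal.ofReal_mul (by have := hφ (ω 0); positivity), ← ENNReal.ofReal_mul (by positivity), hω,
      pathIntegral_sub_const, neg_sub, sub_eq_add_neg, Real.exp_add]
    congr 1
    field_simp
  simp only [Function.comp_def] at h
  rw [lintegral_congr_ae hae, lintegral_const_mul _
    (measurable_exp_neg_pathIntegral' β.continuous t).ennreal_ofReal,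
    ← ofReal_feynmanKacMass, ← ENNReal.ofReal_mul
      (mul_nonneg (inv_nonneg.2 (hφ x).le) (Real.exp_pos _).le)] at h
  rw [integral_eq_lintegral_of_nonneg_ae (ae_of_all _ fun ω => (inv_pos.2 (hφ _)).le)
    (hmeas.mono hm le_rfl).aestronglyMeasurable, h, ENNReal.toReal_ofReal, ← mul_assoc,
    mul_inv_cancel_left₀ (hφ x).ne']
  exact mul_nonneg (mul_nonneg (inv_nonneg.2 (hφ x).le) (Real.exp_pos _).le)
    (feynmanKacMass_pos P β t x).le

/-- Two-sided bounds for the normalised Feynman–Kac mass. -/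
lemma IsSpineLaw.exp_mul_feynmanKacMass_mem_Icc (hP : IsBorelStrongMarkov P) {β φ : E →ᵇ ℝ}
    {lam C₁ C₂ : ℝ} (hC₁ : 0 < C₁) (hφ : ∀ y, C₁ ≤ φ y ∧ φ y ≤ C₂) {x : E}
    {Q : Measure (CadlagPath E)} (hQ : IsSpineLaw P β φ lam x Q) (t : ℝ≥0) :
    Real.exp (lam * t) * feynmanKacMass P β t x ∈ Set.Icc (C₁ * C₂⁻¹) (C₂ * C₁⁻¹) := by
  have hpos : ∀ y, 0 < φ y := fun y => hC₁.trans_le (hφ y).1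
  have hC₂ : 0 < C₂ := (hpos x).trans_le (hφ x).2
  have := hQ.isProbabilityMeasure hP hpos
  have hub : ∀ ω : CadlagPath E, (φ (ω t))⁻¹ ≤ C₁⁻¹ := fun ω => inv_anti₀ hC₁ (hφ _).1
  have hlb : ∀ ω : CadlagPath E, C₂⁻¹ ≤ (φ (ω t))⁻¹ := fun ω => inv_anti₀ (hpos _) (hφ _).2
  have hint : Integrable (fun ω : CadlagPath E => (φ (ω t))⁻¹) Q := by
    refine Integrable.of_bound (φ.continuous.measurable.comp
      (CadlagPath.measurable_eval t)).inv.aestronglyMeasurable C₁⁻¹ (ae_of_all _ fun ω => ?_)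
    simpa [abs_of_pos (hpos _)] using hub ω
  have h₁ : C₂⁻¹ ≤ ∫ ω, (φ (ω t))⁻¹ ∂Q := by
    simpa using integral_mono (integrable_const C₂⁻¹) hint hlb
  have h₂ : ∫ ω, (φ (ω t))⁻¹ ∂Q ≤ C₁⁻¹ := by
    simpa using integral_mono hint (integrable_const C₁⁻¹) hub
  rw [hQ.exp_mul_feynmanKacMass hP hpos t]
  exact ⟨mul_le_mul (hφ x).1 h₁ (inv_pos.2 hC₂).le (hpos x).le,
    mul_le_mul (hφ x).2 h₂ ((inv_pos.2 hC₂).le.trans h₁) hC₂.le⟩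

/-- Under ergodicity of the spine, the normalised Feynman–Kac mass converges to a multiple of the
eigenfunction. -/
lemma IsErgodicSpine.exists_tendsto_feynmanKacMass (hP : IsBorelStrongMarkov P) {β φ : E →ᵇ ℝ}
    {lam C₁ : ℝ} (hC₁ : 0 < C₁) (hφ : ∀ y, C₁ ≤ φ y) (h : IsErgodicSpine P β φ lam) :
    ∃ c : ℝ, 0 < c ∧ ∀ x, Tendsto (fun t : ℝ≥0 => Real.exp (lam * t) * feynmanKacMass P β t x)
      atTop (𝓝 (φ x * c)) := by
  have hpos : ∀ y, 0 < φ y := fun y => hC₁.trans_le (hφ y)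
  have hlaw := h.isSpineLaw
  obtain ⟨π, hπ, -, hlim⟩ := h
  have hmeas : Measurable fun y => (φ y)⁻¹ := φ.continuous.measurable.inv
  have hbd : ∀ y, |(φ y)⁻¹| ≤ C₁⁻¹ := fun y => by
    rw [abs_of_pos (inv_pos.2 (hpos y))]
    exact inv_anti₀ hC₁ (hφ y)
  -- The same constant serves every starting point because π does not depend on it.
  refine ⟨∫ y, (φ y)⁻¹ ∂π, ?_, fun x => ?_⟩
  · rw [integral_pos_iff_support_of_nonneg (fun y => (inv_pos.2 (hpos y)).le)
      (Integrable.of_bound hmeas.aestronglyMeasurable C₁⁻¹ (ae_of_all _ hbd))]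
    have : Function.support (fun y => (φ y)⁻¹) = Set.univ :=
      Set.eq_univ_of_forall fun y => (inv_pos.2 (hpos y)).ne'
    simp [this]
  · simp only [(hlaw x).exp_mul_feynmanKacMass hP hpos]
    exact (tendsto_integral_of_tendsto_iSup (hlim x) hmeas (inv_pos.2 hC₁) hbd).const_mul _

/-- Inserting e^{lam·t} = e^{lam·s} e^{lam·(t-s)} above and below puts both masses in the normalised
form that converges. -/
lemma penalizedDensity_eq (β : E →ᵇ ℝ) (lam : ℝ) (x : E) {s t : ℝ≥0} (hst : s ≤ t)
    (ω : CadlagPath E) :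
    penalizedDensity P β x s t ω = Real.exp (-pathIntegral (fun y => β y - lam) s ω) *
      ((Real.exp (lam * (t - s : ℝ≥0)) * feynmanKacMass P β (t - s) (ω s)) /
        (Real.exp (lam * t) * feynmanKacMass P β t x)) := by
  have he : Real.exp (lam * t) = Real.exp (lam * s) * Real.exp (lam * (t - s : ℝ≥0)) := by
    rw [← Real.exp_add, NNReal.coe_sub hst]
    ring_nf
  rw [penalizedDensity, pathIntegral_sub_const, neg_sub, sub_eq_add_neg, Real.exp_add, he]
  have h₁ := Real.exp_pos (lam * s)
  have h₂ := Real.exp_pos (lam * (t - s : ℝ≥0))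
  field_simp

end Spine

/-! ### Convergence of the densities -/

theorem lemma6p13 {E : Type*} [TopologicalSpace E] [PolishSpace E] [MeasurableSpace E]
    [BorelSpace E] (P : Kernel E (CadlagPath E)) (hP : IsBorelStrongMarkov P)
    (β φ₀ : E →ᵇ ℝ) (lam₀ : ℝ) (hφ₀ : IsEigenfunction P β φ₀ lam₀)
    (hbound : ∃ C₁ C₂ : ℝ, 0 < C₁ ∧ 0 < C₂ ∧ ∀ x, C₁ ≤ φ₀ x ∧ φ₀ x ≤ C₂)
    (hergodic : IsErgodicSpine P β φ₀ lam₀) (x : E) (t₀ : ℝ≥0) :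
    ∃ (Z : ℝ≥0 → CadlagPath E → ℝ) (Zφ : CadlagPath E → ℝ),
      (∀ t, t₀ ≤ t →
        IsRNDerivOn (CadlagPath.filtration E t₀) (penalizedLaw P β t x) (P x) (Z t)) ∧
      IsRNDerivOn (CadlagPath.filtration E t₀) (spineLaw P β φ₀ lam₀ x) (P x) Zφ ∧
      (∀ ω, ContinuousOn (fun t => Z t ω) (Set.Ici t₀)) ∧
      (∀ᵐ ω ∂(P x), Tendsto (fun t => Z t ω) atTop (𝓝 (Zφ ω))) ∧
      Tendsto (fun t => eLpNorm (fun ω => Z t ω - Zφ ω) 1 (P x)) atTop (𝓝 0) := by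
  have := hP.isMarkovKernel
  obtain ⟨C₁, C₂, hC₁, hC₂, hφ⟩ := hbound
  have hpos : ∀ y, 0 < φ₀ y := fun y => hC₁.trans_le (hφ y).1
  have hlaw := hergodic.isSpineLaw
  have hmass := fun y => (hlaw y).exp_mul_feynmanKacMass_mem_Icc hP hC₁ hφ
  obtain ⟨c, hc, hlim⟩ := hergodic.exists_tendsto_feynmanKacMass hP hC₁ fun y => (hφ y).1
  set Zφ : CadlagPath E → ℝ := fun ω => φ₀ (ω t₀) / φ₀ (ω 0) *
    Real.exp (-pathIntegral (fun y => β y - lam₀) t₀ ω) with hZφ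
  have hae : ∀ᵐ ω ∂(P x),
      Tendsto (fun t => penalizedDensity P β x t₀ t ω) atTop (𝓝 (Zφ ω)) := by
    filter_upwards [hP.start x] with ω hω
    have hshift : Tendsto (fun t : ℝ≥0 => t - t₀) atTop atTop :=
      tendsto_atTop.2 fun b => by
        filter_upwards [eventually_ge_atTop (b + t₀)] with t ht using le_tsub_of_add_le_right ht
    have h := (((hlim (ω t₀)).comp hshift).div (hlim x) (mul_pos (hpos x) hc).ne').const_mul
      (Real.exp (-pathIntegral (fun y => β y - lam₀) t₀ ω))
    rw [mul_div_mul_right _ _ hc.ne', mul_comm, ← hω] at h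
    refine h.congr' ?_
    filter_upwards [eventually_ge_atTop t₀] with t ht
    rw [penalizedDensity_eq β lam₀ x ht, hω]
    rfl
  refine ⟨penalizedDensity P β x t₀, Zφ, fun t ht => isRNDerivOn_penalizedLaw hP β x ht,
    hlaw x t₀, fun ω => (continuous_penalizedDensity β x t₀ ω).continuousOn, hae, ?_⟩
  -- The exponential bounds the weight up to `t₀`; the quotient is the upper over the lower bound of
  -- the normalised mass. Their uniformity in the starting point matters, since `ω t₀` is random.
  set K : ℝ := Real.exp (‖β‖ * t₀ + lam₀ * t₀) * (C₂ * C₁⁻¹ / (C₁ * C₂⁻¹)) with hK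
  have hZle : ∀ t, t₀ ≤ t → ∀ ω, penalizedDensity P β x t₀ t ω ≤ K := by
    intro t ht ω
    have hden : 0 < C₁ * C₂⁻¹ := by positivity
    have h₁ := hmass (ω t₀) (t - t₀)
    rw [penalizedDensity_eq β lam₀ x ht, hK]
    refine mul_le_mul (Real.exp_le_exp.2 ?_) (div_le_div₀ (by positivity) h₁.2 hden (hmass x t).1)
      (div_nonneg (hden.le.trans h₁.1) (hden.le.trans (hmass x t).1)) (Real.exp_pos _).le
    have h₂ := (neg_le_abs _).trans (abs_pathIntegral_le β t₀ ω)
    rw [pathIntegral_sub_const]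
    linarith
  have hZm : ∀ t, t₀ ≤ t → Measurable (penalizedDensity P β x t₀ t) := fun t ht =>
    (isRNDerivOn_penalizedLaw hP β x ht).1.mono ((CadlagPath.filtration E).le t₀) le_rfl
  have hZφm : Measurable Zφ := (hlaw x t₀).1.mono ((CadlagPath.filtration E).le t₀) le_rfl
  simp only [eLpNorm_one_eq_lintegral_enorm]
  rw [← lintegral_zero (μ := P x)]
  refine tendsto_lintegral_filter_of_dominated_convergence (fun _ => ENNReal.ofReal K) ?_ ?_ ?_ ?_
  · filter_upwards [eventually_ge_atTop t₀] with t ht using ((hZm t ht).sub hZφm).enorm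
  · filter_upwards [eventually_ge_atTop t₀] with t ht
    filter_upwards [hae] with ω hω
    -- The limit inherits the bound, so both densities lie in [0, K] and differ by at most K.
    have h₁ : Zφ ω ≤ K := le_of_tendsto hω <| by
      filter_upwards [eventually_ge_atTop t₀] with u hu using hZle u hu ω
    have h₂ : 0 ≤ Zφ ω := (hlaw x t₀).2.1 ω
    have h₃ := hZle t ht ω
    have h₄ := (isRNDerivOn_penalizedLaw hP β x ht).2.1 ω
    rw [← ofReal_norm, Real.norm_eq_abs]
    exact ENNReal.ofReal_le_ofReal (abs_sub_le_iff.2 ⟨by linarith, by linarith⟩)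
  · simp
  · filter_upwards [hae] with ω hω
    simpa using (hω.sub_const (Zφ ω)).enorm
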